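/- Let $H=\{\eta\in\mathbb{R}^{d_\eta}\mid A\eta=c\}$ and $\Xi=\{\xi\in\mathbb{R}^{d_\xi}\mid B\xi=e\}$ be nonempty, and consider the bilevel problem $$\min_{\xi\in\Xi}\ u(\xi):=\mathcal{U}(\eta^*(\xi),\xi),\qquad \eta^*(\xi)=\operatorname*{argmin}_{\eta\in H}\mathcal{L}(\eta,\xi).$$ Assume that $\mathcal{U}$ is differentiable and $\mathcal{L}$ twice differentiable on $\mathbb{R}^{d_\eta}\times\mathbb{R}^{d_\xi}$, that $\mathcal{U},\nabla\mathcal{U},\nabla\mathcal{L},\nabla^2\mathcal{L}$ are Lipschitz continuous with constants $\ell_{u,0},\ell_{u,1},\ell_{l,1},\ell_{l,2}$ (Euclidean norms, and the operator norm for $\nabla^2\mathcal L$), that $\mathcal{L}(\cdot,\xi)$ is $\mu_l$-strongly convex with $\mu_l>0$ for every $\xi$, and that $u$ is bounded below on $\Xi$. Given $(\eta^1,\xi^1)$, step sizes $\tau_l,\tau_u>0$ and a number $K_l$, the alternating gradient method computes for $k_u=1,2,\dots$ $$\eta^{k_u,1}=\eta^{k_u},\qquad \eta^{k_u,k_l+1}=\operatorname{Proj}_H\big(\eta^{k_u,k_l}-\tau_l\nabla_\eta\mathcal{L}(\eta^{k_u,k_l},\xi^{k_u})\big)\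 (k_l=1,\dots,K_l),\qquad \eta^{k_u+1}=\eta^{k_u,K_l+1},$$ $$\widehat\nabla u(\xi^{k_u})=\big(\nabla_{\xi^{k_u}}\eta^{k_u+1}\big)^\top\nabla_\eta\mathcal{U}(\eta^{k_u+1},\xi^{k_u})+\nabla_\xi\mathcal{U}(\eta^{k_u+1},\xi^{k_u}),\qquad \xi^{k_u+1}=\operatorname{Proj}_\Xi\big(\xi^{k_u}-\tau_u\widehat\nabla u(\xi^{k_u})\big),$$ where $\operatorname{Proj}$ is the Euclidean projection and $\nabla_{\xi^{k_u}}\eta^{k_u+1}$ is the Jacobian of the map sending $\xi^{k_u}$ to the output $\eta^{k_u+1}$ of the $K_l$ lower-level steps, with the starting point $\eta^{k_u}$ held fixed. Let $0<\tau_l\le\frac{1}{2\ell_{l,1}}$. Then $\eta^*(\xi)$ exists and is unique for every $\xi$, the function $u$ and the maps $\xi\mapsto\eta^{k_u,k_l}$ of the unrolled lower-level steps are differentiable, and there are $\bar\tau>0$ and $\kappa>0$, depending only on $\ell_{u,0},\ell_{u,1},\ell_{l,1},\ell_{l,2},\mu_l,\tau_l$, such that for every $0<\tau_u\le\bar\tau$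 the following holds. There is a constant $C$, depending only on these constants, on $\tau_u$ and on an upper bound $M$ of $u(\xi^1)-\inf_{\Xi}u$, $\|\eta^1-\eta^*(\xi^1)\|$ and $\operatorname{dist}(\xi^1,\Xi)$, such that for all integers $K_u\ge1$ and all integers $K_l\ge\kappa\log K_u$ (for example $K_l=\lceil\kappa\log K_u\rceil=\mathcal{O}(\log K_u)$), the iterates satisfy $$\frac1{K_u}\sum_{k_u=1}^{K_u}\big\|\xi^{k_u}-\operatorname{Proj}_\Xi\big(\xi^{k_u}-\nabla u(\xi^{k_u})\big)\big\|^2\le\frac{C}{K_u}.$$ -/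

import Mathlib

open scoped NNReal Matrix

noncomputable section

/-- The affine subspace `{x ∈ ℝⁿ | A x = c}`. -/
def linearSystem {m n : ℕ} (A : Matrix (Fin m) (Fin n) ℝ) (c : Fin m → ℝ) :
    AffineSubspace ℝ (EuclideanSpace ℝ (Fin n)) where
  carrier := {x | A *ᵥ x.ofLp = c}
  smul_vsub_vadd_mem' t x y z hx hy hz := by
    simp only [Set.mem_ofPred_eq] at hx hy hz
    simp [Matrix.mulVec_add, Matrix.mulVec_smul, Matrix.mulVec_sub, hx, hy, hz]

namespace Bilevel

variable {E F : Type*} [NormedAddCommGroup E] [InnerProductSpace ℝ E] [CompleteSpace E]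
  [NormedAddCommGroup F] [InnerProductSpace ℝ F] [CompleteSpace F]

/-- The function `(η, ξ) ↦ f η ξ` on the product `E × F` with its Euclidean norm. -/
def joint (f : E → F → ℝ) (z : WithLp 2 (E × F)) : ℝ := f z.fst z.snd

/-- Smoothness assumptions on the two objectives: `U`, `∇U`, `∇L`, `∇²L` exist and are Lipschitz
in the pair `(η, ξ)`, with constants `ℓu0`, `ℓu1`, `ℓl1`, `ℓl2`, and `L` is `μ`-strongly convex
in `η` for every fixed `ξ`. The Hessian is the derivative of the gradient, measured in operator
norm. -/
structure Regular (U L : E → F → ℝ) (ℓu0 ℓu1 ℓl1 ℓl2 : ℝ≥0) (μ : ℝ) : Prop where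
  diff_U : Differentiable ℝ (joint U)
  diff_L : Differentiable ℝ (joint L)
  diff_grad_L : Differentiable ℝ (gradient (joint L))
  lip_U : LipschitzWith ℓu0 (joint U)
  lip_grad_U : LipschitzWith ℓu1 (gradient (joint U))
  lip_grad_L : LipschitzWith ℓl1 (gradient (joint L))
  lip_hess_L : LipschitzWith ℓl2 (fderiv ℝ (gradient (joint L)))
  strong : ∀ ξ, StrongConvexOn Set.univ μ fun η => L η ξ

/-- `η` solves the lower-level problem `min {L η' ξ | η' ∈ H}`. -/
def IsLowerSolution (L : E → F → ℝ) (H : AffineSubspace ℝ E) (ξ : F) (η : E) : Prop :=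
  η ∈ H ∧ ∀ η' ∈ H, L η ξ ≤ L η' ξ

/-- The lower-level solution map `η*(ξ) = argmin {L η ξ | η ∈ H}`. -/
def etaStar (L : E → F → ℝ) (H : AffineSubspace ℝ E) (ξ : F) : E :=
  Classical.epsilon (IsLowerSolution L H ξ)

/-- The upper-level objective `u(ξ) = U (η*(ξ)) ξ`. -/
def upperObj (U L : E → F → ℝ) (H : AffineSubspace ℝ E) (ξ : F) : ℝ :=
  U (etaStar L H ξ) ξ

/-- Euclidean projection onto a nonempty affine subspace, as a map of the space to itself. -/
def proj (S : AffineSubspace ℝ E) [Nonempty S] [S.direction.HasOrthogonalProjection] (x : E) : E :=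
  (EuclideanGeometry.orthogonalProjection S x : E)

/-- `K` steps of projected gradient descent with step size `τ` for the lower-level problem at `ξ`,
started at `η`. -/
def lowerIter (L : E → F → ℝ) (H : AffineSubspace ℝ E) [Nonempty H]
    [H.direction.HasOrthogonalProjection] (τ : ℝ) (η : E) (ξ : F) : ℕ → E
  | 0 => η
  | K + 1 =>
    proj H (lowerIter L H τ η ξ K - τ • gradient (fun η' => L η' ξ) (lowerIter L H τ η ξ K))

/-- The hypergradient obtained by unrolled differentiation: with `η⁺(ξ)` the output of `K`
lower-level steps started at the fixed point `η`, it is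
`(∂η⁺/∂ξ)ᵀ ∇_η U (η⁺, ξ) + ∇_ξ U (η⁺, ξ)`. -/
def hyperGrad (U L : E → F → ℝ) (H : AffineSubspace ℝ E) [Nonempty H]
    [H.direction.HasOrthogonalProjection] (τl : ℝ) (K : ℕ) (η : E) (ξ : F) : F :=
  ContinuousLinearMap.adjoint (fderiv ℝ (fun ξ' => lowerIter L H τl η ξ' K) ξ)
      (gradient (fun η' => U η' ξ) (lowerIter L H τl η ξ K))
    + gradient (fun ξ' => U (lowerIter L H τl η ξ K) ξ') ξ

/-- The alternating gradient method with `K` lower-level steps per iteration and step sizes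
`τl`, `τu`. Entry `k` is the pair of iterates `(η, ξ)` after `k` upper-level steps from the
initial pair `(η₁, ξ₁)`; in numbering from one it is the pair with index `k + 1`. -/
def agm (U L : E → F → ℝ) (H : AffineSubspace ℝ E) [Nonempty H]
    [H.direction.HasOrthogonalProjection] (Ξ : AffineSubspace ℝ F) [Nonempty Ξ]
    [Ξ.direction.HasOrthogonalProjection] (τl τu : ℝ) (K : ℕ) (η₁ : E) (ξ₁ : F) : ℕ → E × F
  | 0 => (η₁, ξ₁)
  | k + 1 =>
    let z := agm U L H Ξ τl τu K η₁ ξ₁ k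
    (lowerIter L H τl z.1 z.2 K, proj Ξ (z.2 - τu • hyperGrad U L H τl K z.1 z.2))

/-- The squared projected-gradient stationarity measure `‖ξ - Proj_Ξ (ξ - ∇u(ξ))‖²`. -/
def stationarity (U L : E → F → ℝ) (H : AffineSubspace ℝ E) (Ξ : AffineSubspace ℝ F) [Nonempty Ξ]
    [Ξ.direction.HasOrthogonalProjection] (ξ : F) : ℝ :=
  ‖ξ - proj Ξ (ξ - gradient (upperObj U L H) ξ)‖ ^ 2

end Bilevel

end

/-!
The lower-level step `T(η, ξ) = Proj_H (η - τ ∇_η L(η, ξ))` is a contraction in `η` with a factor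
`q < 1`, uniformly in `ξ` (`Regular.isParamContraction`): its derivative in `η` is a projection
composed with `1 - τ ∇²_ηη L`, and this symmetric operator lies between `0` and `1 - τ μ`.
Everything about the lower level follows from this. Its fixed point is the unique lower-level
solution `η*(ξ)`; implicit differentiation of `T(η*, ξ) = η*` shows that `η*` is differentiable
with bounded and Lipschitz derivative, so `u` has a bounded and Lipschitz gradient; and the
derivatives of the unrolled iterates, which obey the same linear recursion along a sequence
converging to `η*`, converge linearly to the derivative of `η*`
(`IsParamContraction.norm_iterJac_sub_le`).

Hence for any rate `r ∈ (q, 1)` the error of the hypergradient after `K` lower-level steps is at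
most `r ^ K (c₁ + c₂ ‖η - η*(ξ)‖)`. The part with `c₁` does not vanish as `η` approaches `η*(ξ)`,
and this is why `K` has to grow with the number `N` of upper-level steps: for `K ≥ log N / log (1
/ r)` the factor `r ^ K` is at most `1 / N`. Hypergradients are bounded, so `ξ` moves by a bounded
amount in each step and `‖η - η*(ξ)‖` stays bounded. Each error is then `O(1 / N)`, and the
descent inequality for `u` summed over `N` steps bounds the sum of the squared projected gradients
by a constant (`sum_stationarity_le`).
-/

namespace Bilevel

/-! ### Contractions with a parameter -/

section ParamContraction

variable {E F : Type*} [NormedAddCommGroup E] [NormedSpace ℝ E]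
  [NormedAddCommGroup F] [NormedSpace ℝ F]

/-- `T(·, y)` is a family of contractions of `E` with parameter `y ∈ F`: `T` is differentiable in
the pair, with partial derivatives `A` (in `E`) and `B` (in `F`), where `‖A‖ ≤ q < 1`, `‖B‖ ≤ b`,
and `A`, `B` are `a`-Lipschitz for the sum of the norms of the two components. -/
structure IsParamContraction (T : E → F → E) (A : E → F → E →L[ℝ] E) (B : E → F → F →L[ℝ] E)
    (q b a : ℝ) : Prop where
  hasFDerivAt : ∀ x y, HasFDerivAt (fun z : E × F => T z.1 z.2) ((A x y).coprod (B x y)) (x, y)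
  norm_fst_le : ∀ x y, ‖A x y‖ ≤ q
  norm_snd_le : ∀ x y, ‖B x y‖ ≤ b
  lip_fst : ∀ x y x' y', ‖A x y - A x' y'‖ ≤ a * (‖x - x'‖ + ‖y - y'‖)
  lip_snd : ∀ x y x' y', ‖B x y - B x' y'‖ ≤ a * (‖x - x'‖ + ‖y - y'‖)
  nonneg_fst : 0 ≤ q
  fst_lt_one : q < 1
  nonneg_snd : 0 ≤ b
  nonneg_lip : 0 ≤ a

/-- The derivative in `y` of the `k`-th iterate of `T(·, y)` started at a fixed `x`, given by the
recursion of forward differentiation `D₀ = 0`, `Dₖ₊₁ = A Dₖ + B`, where `A`, `B` are the partial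
derivatives of `T`. -/
def iterJac (T : E → F → E) (A : E → F → E →L[ℝ] E) (B : E → F → F →L[ℝ] E) (x : E) (y : F) :
    ℕ → F →L[ℝ] E
  | 0 => 0
  | k + 1 => A ((fun x' => T x' y)^[k] x) y ∘L iterJac T A B x y k + B ((fun x' => T x' y)^[k] x) y

namespace IsParamContraction

variable {T : E → F → E} {A : E → F → E →L[ℝ] E} {B : E → F → F →L[ℝ] E} {q b a : ℝ}

lemma norm_sub_le_fst (h : IsParamContraction T A B q b a) (x x' : E) (y : F) :
    ‖T x y - T x' y‖ ≤ q * ‖x - x'‖ := by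
  have hd : ∀ z, HasFDerivAt (fun z => T z y) (A z y) z := fun z => by
    have := HasFDerivAt.comp (f := fun z => (z, y)) z (h.hasFDerivAt z y)
      ((hasFDerivAt_id z).prodMk (hasFDerivAt_const y z))
    refine this.congr_fderiv ?_
    ext v; simp
  exact Convex.norm_image_sub_le_of_norm_hasFDerivWithin_le (s := Set.univ)
    (fun z _ => (hd z).hasFDerivWithinAt) (fun z _ => h.norm_fst_le z y) convex_univ trivial trivial

lemma norm_sub_le_snd (h : IsParamContraction T A B q b a) (x : E) (y y' : F) :
    ‖T x y - T x y'‖ ≤ b * ‖y - y'‖ := by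
  have hd : ∀ z, HasFDerivAt (fun z => T x z) (B x z) z := fun z => by
    have := HasFDerivAt.comp (f := fun z => (x, z)) z (h.hasFDerivAt x z)
      ((hasFDerivAt_const x z).prodMk (hasFDerivAt_id z))
    refine this.congr_fderiv ?_
    ext v; simp
  exact Convex.norm_image_sub_le_of_norm_hasFDerivWithin_le (s := Set.univ)
    (fun z _ => (hd z).hasFDerivWithinAt) (fun z _ => h.norm_snd_le x z) convex_univ trivial trivial

lemma exists_fixedPoint [CompleteSpace E] (h : IsParamContraction T A B q b a) (y : F) :
    ∃ x, T x y = x := by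
  have hc : ContractingWith ⟨q, h.nonneg_fst⟩ (fun x => T x y) :=
    ⟨by exact_mod_cast h.fst_lt_one,
      LipschitzWith.of_dist_le_mul fun x x' => by
        rw [dist_eq_norm, dist_eq_norm]; exact h.norm_sub_le_fst x x' y⟩
  exact ⟨_, hc.fixedPoint_isFixedPt⟩

lemma one_sub_pos (h : IsParamContraction T A B q b a) : 0 < 1 - q := by linarith [h.fst_lt_one]

lemma hasFDerivAt_iterate (h : IsParamContraction T A B q b a) (x : E) (y : F) (k : ℕ) :
    HasFDerivAt (fun y' => (fun x' => T x' y')^[k] x) (iterJac T A B x y k) y := by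
  induction k with
  | zero => simpa [iterJac] using hasFDerivAt_const x y
  | succ k ih =>
    simp only [Function.iterate_succ_apply', iterJac]
    have := HasFDerivAt.comp (f := fun y' => ((fun x' => T x' y')^[k] x, y')) y
      (h.hasFDerivAt ((fun x' => T x' y)^[k] x) y) (ih.prodMk (hasFDerivAt_id y))
    refine this.congr_fderiv ?_
    ext v; simp

lemma norm_iterJac_le (h : IsParamContraction T A B q b a) (x : E) (y : F) (k : ℕ) :
    ‖iterJac T A B x y k‖ ≤ b / (1 - q) := by
  have h1 := h.one_sub_pos
  induction k with
  | zero => simpa [iterJac] using div_nonneg h.nonneg_snd h1.le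
  | succ k ih =>
    calc _ ≤ q * (b / (1 - q)) + b := by
          refine (norm_add_le _ _).trans (add_le_add ?_ (h.norm_snd_le _ _))
          refine (ContinuousLinearMap.opNorm_comp_le _ _).trans ?_
          exact mul_le_mul (h.norm_fst_le _ _) ih (norm_nonneg _) h.nonneg_fst
      _ = b / (1 - q) := by field_simp; ring

variable {s : F → E}

lemma norm_iterate_sub_le (h : IsParamContraction T A B q b a) (hs : ∀ y, T (s y) y = s y)
    (x : E) (y : F) (k : ℕ) :
    ‖(fun x' => T x' y)^[k] x - s y‖ ≤ q ^ k * ‖x - s y‖ := by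
  induction k with
  | zero => simp
  | succ k ih =>
    rw [Function.iterate_succ_apply']
    have := h.norm_sub_le_fst ((fun x' => T x' y)^[k] x) (s y) y
    rw [hs] at this
    refine this.trans ?_
    rw [pow_succ', mul_assoc]
    exact mul_le_mul_of_nonneg_left ih h.nonneg_fst

lemma norm_fixedPoint_sub_le (h : IsParamContraction T A B q b a) (hs : ∀ y, T (s y) y = s y)
    (y y' : F) : ‖s y - s y'‖ ≤ b / (1 - q) * ‖y - y'‖ := by
  have h1 := h.one_sub_pos
  have h2 : ‖s y - s y'‖ ≤ q * ‖s y - s y'‖ + b * ‖y - y'‖ := by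
    calc ‖s y - s y'‖ = ‖(T (s y) y - T (s y') y) + (T (s y') y - T (s y') y')‖ := by
          rw [hs y, hs y']; congr 1; abel
      _ ≤ _ := (norm_add_le _ _).trans
          (add_le_add (h.norm_sub_le_fst _ _ _) (h.norm_sub_le_snd _ _ _))
  rw [div_mul_eq_mul_div, le_div_iff₀ h1]
  linarith

/-- The equation that implicit differentiation of `T (s y) y = s y` gives for the derivative of `s`
is solvable. -/
lemma exists_linearized_fixedPoint [CompleteSpace E] (h : IsParamContraction T A B q b a)
    (x : E) (y : F) : ∃ D : F →L[ℝ] E, D = A x y ∘L D + B x y := by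
  have hc : ContractingWith ⟨q, h.nonneg_fst⟩ (fun D => A x y ∘L D + B x y) :=
    ⟨by exact_mod_cast h.fst_lt_one,
      LipschitzWith.of_dist_le_mul fun D D' => by
        rw [dist_add_right, dist_eq_norm, dist_eq_norm, ← ContinuousLinearMap.comp_sub]
        exact (ContinuousLinearMap.opNorm_comp_le _ _).trans
          (mul_le_mul_of_nonneg_right (h.norm_fst_le _ _) (norm_nonneg _))⟩
  exact ⟨_, hc.fixedPoint_isFixedPt.symm⟩

variable {D : F → F →L[ℝ] E}

/-- The fixed point is a differentiable function of the parameter. For `w = s y' - s y - D (y' - y)`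
the two fixed point equations and the equation for `D` give `w - A w = o(y' - y)`, and
`‖w - A w‖ ≥ (1 - q) ‖w‖`. -/
lemma hasFDerivAt_fixedPoint (h : IsParamContraction T A B q b a) (hs : ∀ y, T (s y) y = s y)
    (hD : ∀ y, D y = A (s y) y ∘L D y + B (s y) y) (y : F) : HasFDerivAt s (D y) y := by
  have h1 := h.one_sub_pos
  have hsc : Filter.Tendsto (fun y' => (s y', y')) (nhds y) (nhds (s y, y)) := by
    have hl : LipschitzWith ⟨b / (1 - q), div_nonneg h.nonneg_snd h1.le⟩ s :=
      LipschitzWith.of_dist_le_mul fun z z' => by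
        rw [dist_eq_norm, dist_eq_norm]; exact h.norm_fixedPoint_sub_le hs z z'
    exact (hl.continuous.prodMk continuous_id).continuousAt
  have hlo := ((h.hasFDerivAt (s y) y).isLittleO.comp_tendsto hsc)
  have hO : ((fun z : E × F => z - (s y, y)) ∘ fun y' => (s y', y')) =O[nhds y]
      fun y' => y' - y := by
    refine Asymptotics.IsBigO.of_bound (max (b / (1 - q)) 1) (Filter.Eventually.of_forall ?_)
    intro y'
    simp only [Function.comp, Prod.mk_sub_mk, Prod.norm_mk]
    refine max_le ((h.norm_fixedPoint_sub_le hs y' y).trans ?_) ?_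
    · gcongr; exact le_max_left _ _
    · exact le_mul_of_one_le_left (norm_nonneg _) (le_max_right _ _)
  have hlo2 := hlo.trans_isBigO hO
  refine HasFDerivAt.of_isLittleO ?_
  refine Asymptotics.IsBigO.trans_isLittleO ?_ hlo2
  refine Asymptotics.IsBigO.of_bound (1 / (1 - q)) (Filter.Eventually.of_forall fun y' => ?_)
  simp only [Function.comp, Prod.mk_sub_mk, ContinuousLinearMap.coprod_apply, hs]
  set w := s y' - s y - D y (y' - y) with hw
  have e1 : s y' - s y - (A (s y) y (s y' - s y) + B (s y) y (y' - y)) = w - A (s y) y w := by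
    have : D y (y' - y) = A (s y) y (D y (y' - y)) + B (s y) y (y' - y) := by
      conv_lhs => rw [hD y]
      simp
    rw [hw, map_sub (A (s y) y) (s y' - s y)]
    nth_rewrite 1 [this]
    abel
  rw [e1, one_div, inv_mul_eq_div, le_div_iff₀ h1]
  have h3 : ‖A (s y) y w‖ ≤ q * ‖w‖ := (A (s y) y).le_of_opNorm_le (h.norm_fst_le _ _) w
  linarith [norm_sub_norm_le w (A (s y) y w)]

lemma norm_deriv_fixedPoint_le (h : IsParamContraction T A B q b a)
    (hD : ∀ y, D y = A (s y) y ∘L D y + B (s y) y) (y : F) : ‖D y‖ ≤ b / (1 - q) := by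
  have h1 := h.one_sub_pos
  have h2 : ‖D y‖ ≤ q * ‖D y‖ + b := by
    conv_lhs => rw [hD y]
    refine (norm_add_le _ _).trans (add_le_add ?_ (h.norm_snd_le _ _))
    exact (ContinuousLinearMap.opNorm_comp_le _ _).trans
      (mul_le_mul_of_nonneg_right (h.norm_fst_le _ _) (norm_nonneg _))
  rw [le_div_iff₀ h1]
  linarith

/-- Stability of the recursion `G ↦ A G + B` under a change of the base point. -/
lemma norm_linearized_sub_le (h : IsParamContraction T A B q b a) (x x' : E) (y y' : F)
    (G G' : F →L[ℝ] E) (hG' : ‖G'‖ ≤ b / (1 - q)) :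
    ‖(A x y ∘L G + B x y) - (A x' y' ∘L G' + B x' y')‖
      ≤ q * ‖G - G'‖ + a * (1 + b / (1 - q)) * (‖x - x'‖ + ‖y - y'‖) := by
  have e : (A x y ∘L G + B x y) - (A x' y' ∘L G' + B x' y')
      = A x y ∘L (G - G') + ((A x y - A x' y') ∘L G' + (B x y - B x' y')) := by
    rw [ContinuousLinearMap.comp_sub, ContinuousLinearMap.sub_comp]; abel
  have h1 : ‖A x y ∘L (G - G')‖ ≤ q * ‖G - G'‖ :=
    (ContinuousLinearMap.opNorm_comp_le _ _).trans
      (mul_le_mul_of_nonneg_right (h.norm_fst_le _ _) (norm_nonneg _))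
  have hn : 0 ≤ a * (‖x - x'‖ + ‖y - y'‖) := mul_nonneg h.nonneg_lip (by positivity)
  have h2 : ‖(A x y - A x' y') ∘L G'‖ ≤ a * (‖x - x'‖ + ‖y - y'‖) * (b / (1 - q)) :=
    (ContinuousLinearMap.opNorm_comp_le _ _).trans
      (mul_le_mul (h.lip_fst _ _ _ _) hG' (norm_nonneg _) hn)
  rw [e]
  refine (norm_add_le _ _).trans ?_
  have := norm_add_le ((A x y - A x' y') ∘L G') (B x y - B x' y')
  have := h.lip_snd x y x' y'
  linarith

lemma norm_deriv_fixedPoint_sub_le (h : IsParamContraction T A B q b a)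
    (hs : ∀ y, T (s y) y = s y) (hD : ∀ y, D y = A (s y) y ∘L D y + B (s y) y) (y y' : F) :
    ‖D y - D y'‖ ≤ a * (1 + b / (1 - q)) ^ 2 / (1 - q) * ‖y - y'‖ := by
  have h1 := h.one_sub_pos
  have h2 := h.norm_linearized_sub_le (s y) (s y') y y' (D y) (D y')
    (h.norm_deriv_fixedPoint_le hD y')
  rw [← hD y, ← hD y'] at h2
  have h3 : ‖s y - s y'‖ + ‖y - y'‖ ≤ (1 + b / (1 - q)) * ‖y - y'‖ := by
    linarith [h.norm_fixedPoint_sub_le hs y y']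
  have h4 : 0 ≤ a * (1 + b / (1 - q)) :=
    mul_nonneg h.nonneg_lip (add_nonneg zero_le_one (div_nonneg h.nonneg_snd h1.le))
  have h5 := mul_le_mul_of_nonneg_left h3 h4
  rw [div_mul_eq_mul_div, le_div_iff₀ h1]
  linarith

/-- The derivatives of the iterates converge linearly to the derivative of the fixed point. The
base points converge only at the rate `q`, so the recursion `aₖ₊₁ ≤ q aₖ + c qᵏ` costs a factor `k`,
which is absorbed by passing to a rate `r > q`. -/
lemma norm_iterJac_sub_le (h : IsParamContraction T A B q b a)
    (hs : ∀ y, T (s y) y = s y) (hD : ∀ y, D y = A (s y) y ∘L D y + B (s y) y)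
    {r : ℝ} (hr : q < r) (x : E) (y : F) (k : ℕ) :
    ‖iterJac T A B x y k - D y‖
      ≤ r ^ k * (b / (1 - q) + a * (1 + b / (1 - q)) / (r - q) * ‖x - s y‖) := by
  have h1 := h.one_sub_pos
  have hrq : 0 < r - q := sub_pos.2 hr
  have hr0 : 0 ≤ r := h.nonneg_fst.trans hr.le
  have hd : 0 ≤ b / (1 - q) := div_nonneg h.nonneg_snd h1.le
  have hc : 0 ≤ a * (1 + b / (1 - q)) := mul_nonneg h.nonneg_lip (by linarith)
  induction k with
  | zero =>
    simp only [iterJac, zero_sub, norm_neg, pow_zero, one_mul]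
    exact (h.norm_deriv_fixedPoint_le hD y).trans (le_add_of_nonneg_right (by positivity))
  | succ k ih =>
    have h2 := h.norm_linearized_sub_le ((fun x' => T x' y)^[k] x) (s y) y y
      (iterJac T A B x y k) (D y) (h.norm_deriv_fixedPoint_le hD y)
    rw [← hD y, sub_self, norm_zero, add_zero] at h2
    have h3 : ‖(fun x' => T x' y)^[k] x - s y‖ ≤ r ^ k * ‖x - s y‖ :=
      (h.norm_iterate_sub_le hs x y k).trans
        (mul_le_mul_of_nonneg_right (pow_le_pow_left₀ h.nonneg_fst hr.le k) (norm_nonneg _))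
    refine h2.trans ?_
    set c := a * (1 + b / (1 - q))
    set d := b / (1 - q)
    set w := ‖x - s y‖
    have h4 := mul_le_mul_of_nonneg_left ih h.nonneg_fst
    have h5 := mul_le_mul_of_nonneg_left h3 hc
    have h6 : q * d ≤ r * d := mul_le_mul_of_nonneg_right hr.le hd
    have h7 : r ^ k * (q * d) ≤ r ^ k * (r * d) :=
      mul_le_mul_of_nonneg_left h6 (pow_nonneg hr0 k)
    have h8 : r ^ (k + 1) * (d + c / (r - q) * w)
        = r ^ k * (r * d) + q * (r ^ k * (c / (r - q) * w)) + c * (r ^ k * w) := by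
      field_simp; ring
    linarith

end IsParamContraction

end ParamContraction

/-! ### Projection onto an affine subspace -/

section Projection

variable {E : Type*} [NormedAddCommGroup E] [InnerProductSpace ℝ E]
  (S : AffineSubspace ℝ E) [Nonempty S] [S.direction.HasOrthogonalProjection]

lemma proj_mem (x : E) : proj S x ∈ S := EuclideanGeometry.orthogonalProjection_mem x

lemma proj_add (x v : E) : proj S (x + v) = proj S x + S.direction.starProjection v := by
  have := congrArg (fun p : S => (p : E))
    ((EuclideanGeometry.orthogonalProjection S).toAffineMap.map_vadd x v)
  rw [vadd_eq_add, add_comm] at this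
  refine this.trans ?_
  rw [add_comm (proj S x)]
  rfl

lemma proj_of_mem {x : E} (hx : x ∈ S) : proj S x = x :=
  EuclideanGeometry.orthogonalProjection_eq_self_iff.2 hx

lemma proj_sub (x v : E) : proj S (x - v) = proj S x - S.direction.starProjection v := by
  rw [sub_eq_add_neg, proj_add, map_neg, sub_eq_add_neg]

lemma norm_sub_proj_sub (x v : E) :
    ‖x - proj S (x - v)‖ ≤ ‖x - proj S x‖ + ‖v‖ := by
  rw [proj_sub, ← sub_add]
  exact (norm_add_le _ _).trans
    (add_le_add_right (S.direction.norm_starProjection_apply_le v) _)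

end Projection

/-! ### Perturbation of a hypergradient -/

section Objective

variable {E F : Type*} [NormedAddCommGroup E] [InnerProductSpace ℝ E] [CompleteSpace E]
  [NormedAddCommGroup F] [InnerProductSpace ℝ F] [CompleteSpace F]

lemma norm_adjoint_apply_add_sub_le {D D' : F →L[ℝ] E} {g g' : E} {p p' : F} {d m e : ℝ}
    (hD' : ‖D'‖ ≤ d) (hg : ‖g‖ ≤ m) (hgg : ‖g - g'‖ ≤ e) (hpp : ‖p - p'‖ ≤ e) :
    ‖(D.adjoint g + p) - (D'.adjoint g' + p')‖ ≤ ‖D - D'‖ * m + (d + 1) * e := by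
  have h1 : (D.adjoint g + p) - (D'.adjoint g' + p')
      = (D - D').adjoint g + (D'.adjoint (g - g') + (p - p')) := by
    simp only [map_sub, sub_apply]; abel
  have h2 : ‖(D - D').adjoint g‖ ≤ ‖D - D'‖ * m := by
    refine ((D - D').adjoint.le_opNorm g).trans ?_
    rw [LinearIsometryEquiv.norm_map]
    exact mul_le_mul_of_nonneg_left hg (norm_nonneg _)
  have h3 : ‖D'.adjoint (g - g')‖ ≤ d * e := by
    refine (D'.adjoint.le_opNorm _).trans ?_
    rw [LinearIsometryEquiv.norm_map]
    exact mul_le_mul hD' hgg (norm_nonneg _) ((norm_nonneg _).trans hD')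
  rw [h1]
  refine (norm_add_le _ _).trans ?_
  have := norm_add_le (D'.adjoint (g - g')) (p - p')
  linarith

lemma norm_adjoint_apply_add_le {D : F →L[ℝ] E} {g : E} {p : F} {d m : ℝ}
    (hD : ‖D‖ ≤ d) (hg : ‖g‖ ≤ m) (hp : ‖p‖ ≤ m) : ‖D.adjoint g + p‖ ≤ (d + 1) * m := by
  have h1 : ‖D.adjoint g‖ ≤ d * m := by
    refine (D.adjoint.le_opNorm _).trans ?_
    rw [LinearIsometryEquiv.norm_map]
    exact mul_le_mul hD hg (norm_nonneg _) ((norm_nonneg _).trans hD)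
  linarith [norm_add_le (D.adjoint g) p]

end Objective

/-! ### Inexact projected gradient descent -/

section Convergence

variable {F : Type*} [NormedAddCommGroup F] [InnerProductSpace ℝ F] [CompleteSpace F]

lemma abs_sub_le_of_norm_gradient_le {u : F → ℝ} {g : F → F} (hu : ∀ x, HasGradientAt u (g x) x)
    {G : ℝ} (hG : ∀ x, ‖g x‖ ≤ G) (x y : F) : |u y - u x| ≤ G * ‖y - x‖ :=
  Convex.norm_image_sub_le_of_norm_hasFDerivWithin_le (s := Set.univ)
    (fun z _ => (hu z).hasFDerivAt.hasFDerivWithinAt) (fun z _ => by simpa using hG z)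
    convex_univ trivial trivial

/-- The descent lemma, with the constant `ℓ` of the mean value inequality in place of the sharp
`ℓ / 2`. -/
lemma sub_le_inner_add_sq {u : F → ℝ} {g : F → F} (hu : ∀ x, HasGradientAt u (g x) x)
    {ℓ : ℝ} (hℓ : ∀ x y, ‖g x - g y‖ ≤ ℓ * ‖x - y‖) (hℓ0 : 0 ≤ ℓ) (x y : F) :
    u y - u x ≤ inner ℝ (g x) (y - x) + ℓ * ‖y - x‖ ^ 2 := by
  have := Convex.norm_image_sub_le_of_norm_hasFDerivWithin_le' (s := segment ℝ x y)
    (φ := InnerProductSpace.toDual ℝ F (g x)) (C := ℓ * ‖y - x‖)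
    (fun z _ => (hu z).hasFDerivAt.hasFDerivWithinAt) (fun z hz => by
      rw [← map_sub, LinearIsometryEquiv.norm_map]
      refine (hℓ z x).trans (mul_le_mul_of_nonneg_left ?_ hℓ0)
      exact norm_sub_le_of_mem_segment hz)
    (convex_segment x y) (left_mem_segment ℝ x y) (right_mem_segment ℝ x y)
  have h2 := (le_abs_self _).trans this
  rw [InnerProductSpace.toDual_apply_apply] at h2
  linarith [h2]

variable (S : AffineSubspace ℝ F) [Nonempty S] [S.direction.HasOrthogonalProjection]

/-- One inexact projected gradient step from a point of `S` decreases `u` by a multiple of the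
squared projected gradient, up to the squared error of the direction. -/
lemma sq_norm_starProjection_gradient_le {u : F → ℝ} {g : F → F}
    (hu : ∀ x, HasGradientAt u (g x) x) {ℓ : ℝ} (hℓ : ∀ x y, ‖g x - g y‖ ≤ ℓ * ‖x - y‖)
    (hℓ0 : 0 ≤ ℓ) {τ : ℝ} (hτ : 0 < τ) (hτℓ : 2 * ℓ * τ ≤ 1) {x : F} (hx : x ∈ S) (v : F)
    {δ : ℝ} (hv : ‖v - g x‖ ≤ δ) :
    ‖S.direction.starProjection (g x)‖ ^ 2
      ≤ 2 / τ * (u x - u (proj S (x - τ • v))) + δ ^ 2 := by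
  set P := S.direction.starProjection
  have hstep : proj S (x - τ • v) - x = -(τ • P v) := by
    rw [proj_sub, proj_of_mem S hx, map_smul]; abel
  have hdesc := sub_le_inner_add_sq hu hℓ hℓ0 x (proj S (x - τ • v))
  rw [hstep, norm_neg, norm_smul, inner_neg_right, inner_smul_right, Real.norm_eq_abs, mul_pow,
    sq_abs] at hdesc
  have hin : inner ℝ (g x) (P v) = inner ℝ (P (g x)) (P v) := by
    rw [Submodule.inner_starProjection_left_eq_right,
      Submodule.starProjection_eq_self_iff.2 (Submodule.starProjection_apply_mem _ v)]
  have hpol : ‖P v - P (g x)‖ ^ 2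
      = ‖P v‖ ^ 2 - 2 * inner ℝ (P (g x)) (P v) + ‖P (g x)‖ ^ 2 := by
    rw [norm_sub_sq_real, real_inner_comm]
  have herr : ‖P v - P (g x)‖ ^ 2 ≤ δ ^ 2 := by
    rw [← map_sub]
    exact pow_le_pow_left₀ (norm_nonneg _)
      ((S.direction.norm_starProjection_apply_le _).trans hv) 2
  have h1 : ℓ * (τ ^ 2 * ‖P v‖ ^ 2) ≤ τ / 2 * ‖P v‖ ^ 2 := by
    have : ℓ * τ ^ 2 ≤ τ / 2 := by nlinarith
    nlinarith [sq_nonneg ‖P v‖]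
  rw [hin] at hdesc
  have h2 : τ / 2 * ‖P (g x)‖ ^ 2 ≤ (u x - u (proj S (x - τ • v))) + τ / 2 * δ ^ 2 := by
    have := mul_le_mul_of_nonneg_left herr (half_pos hτ).le
    rw [hpol] at this
    linarith
  have h3 : 2 / τ * (τ / 2 * ‖P (g x)‖ ^ 2) = ‖P (g x)‖ ^ 2 := by field_simp
  rw [← h3]
  refine (mul_le_mul_of_nonneg_left h2 (by positivity)).trans (le_of_eq ?_)
  field_simp

/-- Projected gradient descent with directions `v k` whose error is at most `ε (c₁ + c₂ e k)`, where
`e` is a tracking error damped by the factor `ε ≤ 1 / N` and excited by the steps. As `v` is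
bounded, so are the steps, hence `e`; every squared error is then `O(1 / N²)`, and the `N` of them sum to a
constant. The starting point need not lie in `S`, so its term is estimated separately. -/
lemma sum_stationarity_le {u : F → ℝ} {g : F → F}
    (hu : ∀ x, HasGradientAt u (g x) x) {G : ℝ} (hG : ∀ x, ‖g x‖ ≤ G)
    {ℓ : ℝ} (hℓ : ∀ x y, ‖g x - g y‖ ≤ ℓ * ‖x - y‖) (hℓ0 : 0 ≤ ℓ)
    {τ : ℝ} (hτ : 0 < τ) (hτℓ : 2 * ℓ * τ ≤ 1)
    {ξ v : ℕ → F} {e : ℕ → ℝ} (he : ∀ k, 0 ≤ e k)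
    (hξ : ∀ k, ξ (k + 1) = proj S (ξ k - τ • v k)) (hvG : ∀ k, ‖v k‖ ≤ G)
    {N : ℕ} (hN : 1 ≤ N) {ε c₁ c₂ d : ℝ} (hε0 : 0 ≤ ε) (hεN : ε ≤ 1 / N)
    (hc₂ : 0 ≤ c₂) (hd : 0 ≤ d)
    (hv : ∀ k, ‖v k - g (ξ k)‖ ≤ ε * (c₁ + c₂ * e k))
    (hestep : ∀ k, e (k + 1) ≤ ε * e k + d * ‖ξ k - ξ (k + 1)‖)
    {M : ℝ} (hMu : ∀ x ∈ S, u (ξ 0) - u x ≤ M) (hMe : e 0 ≤ M) (hMξ : ‖ξ 0 - proj S (ξ 0)‖ ≤ M) :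
    ∑ k ∈ Finset.range N, ‖ξ k - proj S (ξ k - g (ξ k))‖ ^ 2
      ≤ (M + G) ^ 2 + (2 / τ * (M + G * (M + τ * G))
        + (c₁ + c₂ * (M + 2 * (d * (M + τ * G)))) ^ 2) := by
  have hG0 : 0 ≤ G := (norm_nonneg _).trans (hG (ξ 0))
  have hM0 : 0 ≤ M := (he 0).trans hMe
  set s := M + τ * G with hs
  have hs0 : 0 ≤ s := by positivity
  set m := M + 2 * (d * s) with hm
  have hm0 : 0 ≤ m := by positivity
  obtain ⟨n, rfl⟩ : ∃ n, N = n + 1 := ⟨N - 1, by omega⟩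
  have hmem : ∀ k, ξ (k + 1) ∈ S := fun k => by rw [hξ]; exact proj_mem S _
  have hfirst : ‖ξ 0 - proj S (ξ 0 - g (ξ 0))‖ ^ 2 ≤ (M + G) ^ 2 :=
    pow_le_pow_left₀ (norm_nonneg _)
      ((norm_sub_proj_sub S _ _).trans (add_le_add hMξ (hG _))) 2
  have hτv : ∀ k, ‖τ • v k‖ ≤ τ * G := fun k => by
    rw [norm_smul, Real.norm_of_nonneg hτ.le]
    exact mul_le_mul_of_nonneg_left (hvG k) hτ.le
  have hstep : ∀ k, ‖ξ k - ξ (k + 1)‖ ≤ s := by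
    intro k
    rw [hξ k]
    refine (norm_sub_proj_sub S _ _).trans (add_le_add ?_ (hτv k))
    cases k with
    | zero => exact hMξ
    | succ k => simpa [proj_of_mem S (hmem k)] using hM0
  rw [Finset.sum_range_succ']
  rw [add_comm]
  refine add_le_add hfirst ?_
  -- For `N = 1` the factor `ε` may be `1`, and `e` is not damped; the sum has only the first term.
  rcases Nat.eq_zero_or_pos n with rfl | hn
  · simp only [Finset.range_zero, Finset.sum_empty]; positivity
  have hε2 : ε ≤ 1 / 2 := by
    refine hεN.trans ?_
    have : (1 : ℝ) ≤ n := by exact_mod_cast hn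
    push_cast
    exact one_div_le_one_div_of_le (by norm_num) (by linarith)
  have hem : ∀ k, e k ≤ m := by
    intro k
    induction k with
    | zero => exact hMe.trans (le_add_of_nonneg_right (by positivity))
    | succ k ih =>
      have h1 : ε * e k ≤ 1 / 2 * m := mul_le_mul hε2 ih (he k) (by norm_num)
      have h2 := mul_le_mul_of_nonneg_left (hstep k) hd
      linarith [hestep k]
  have hδ : ∀ k, ‖v k - g (ξ k)‖ ≤ ε * (c₁ + c₂ * m) := fun k =>
    (hv k).trans (mul_le_mul_of_nonneg_left
      (add_le_add_right (mul_le_mul_of_nonneg_left (hem k) hc₂) _) hε0)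
  have hterm : ∀ k ∈ Finset.range n, ‖ξ (k + 1) - proj S (ξ (k + 1) - g (ξ (k + 1)))‖ ^ 2
      ≤ 2 / τ * (u (ξ (k + 1)) - u (ξ (k + 2))) + (ε * (c₁ + c₂ * m)) ^ 2 := by
    intro k _
    rw [proj_sub, proj_of_mem S (hmem k), sub_sub_cancel, hξ (k + 1)]
    exact sq_norm_starProjection_gradient_le S hu hℓ hℓ0 hτ hτℓ (hmem k) _ (hδ _)
  refine (Finset.sum_le_sum hterm).trans ?_
  rw [Finset.sum_add_distrib, ← Finset.mul_sum, Finset.sum_range_sub' (fun k => u (ξ (k + 1)))]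
  refine add_le_add (mul_le_mul_of_nonneg_left ?_ (by positivity)) ?_
  · have h1 := abs_sub_le_of_norm_gradient_le hu hG (ξ 1) (ξ 0)
    have h2 := mul_le_mul_of_nonneg_left (hstep 0) hG0
    have h3 := (abs_le.1 h1).1
    have h4 := hMu _ (hmem n)
    simp only [zero_add] at h2 ⊢
    linarith
  · rw [Finset.sum_const, Finset.card_range, nsmul_eq_mul, mul_pow, ← mul_assoc]
    refine mul_le_of_le_one_left (sq_nonneg _) ?_
    have h1 : (n + 1 : ℝ) * ε ≤ 1 := by
      rw [le_div_iff₀ (by positivity)] at hεN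
      push_cast at hεN
      linarith
    have h2 : (n : ℝ) * ε ≤ 1 := by linarith
    have : (n : ℝ) * ε ^ 2 = (n * ε) * ε := by ring
    rw [this]
    exact mul_le_one₀ h2 hε0 (by linarith)

end Convergence

/-! ### Gradient steps on strongly convex functions -/

section StrongConvexity

variable {E : Type*} [NormedAddCommGroup E] [InnerProductSpace ℝ E]

lemma norm_le_of_symmetric_of_inner_le {S : E →L[ℝ] E} {q : ℝ} (hq : 0 ≤ q)
    (hsymm : ∀ v w, inner ℝ (S v) w = inner ℝ v (S w))
    (hnonneg : ∀ v, 0 ≤ inner ℝ (S v) v) (hle : ∀ v, inner ℝ (S v) v ≤ q * ‖v‖ ^ 2) :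
    ‖S‖ ≤ q := by
  have hsym : S.IsSymmetric := fun v w => hsymm v w
  rw [ContinuousLinearMap.norm_eq_iSup_rayleighQuotient S hsym]
  refine ciSup_le fun v => ?_
  have h1 : S.rayleighQuotient v = inner ℝ (S v) v / ‖v‖ ^ 2 := rfl
  rw [h1, abs_of_nonneg (div_nonneg (hnonneg v) (sq_nonneg _))]
  exact div_le_of_le_mul₀ (sq_nonneg _) hq (hle v)

variable [CompleteSpace E]

lemma _root_.StrongConvexOn.add_inner_le {f : E → ℝ} {μ : ℝ} (hf : StrongConvexOn Set.univ μ f)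
    {x g : E} (hg : HasGradientAt f g x) (y : E) :
    f x + inner ℝ g (y - x) + μ / 2 * ‖y - x‖ ^ 2 ≤ f y := by
  have hd : HasDerivAt (fun t : ℝ => f (x + t • (y - x))) (inner ℝ g (y - x)) 0 := by
    have h1 : HasDerivAt (fun t : ℝ => x + t • (y - x)) (y - x) 0 := by
      simpa using ((hasDerivAt_id (0 : ℝ)).smul_const (y - x)).const_add x
    have h2 : HasFDerivAt f (InnerProductSpace.toDual ℝ E g) (x + (0 : ℝ) • (y - x)) := by
      simpa using hg.hasFDerivAt
    exact h2.comp_hasDerivAt (0 : ℝ) h1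
  have ht := hd.tendsto_slope_zero_right
  have ht2 : Filter.Tendsto (fun t : ℝ => f y - f x - (1 - t) * (μ / 2 * ‖y - x‖ ^ 2))
      (nhdsWithin 0 (Set.Ioi 0)) (nhds (f y - f x - (1 - 0) * (μ / 2 * ‖y - x‖ ^ 2))) :=
    (Continuous.tendsto (by fun_prop) 0).mono_left nhdsWithin_le_nhds
  have := le_of_tendsto_of_tendsto ht ht2 ?_
  · linarith
  filter_upwards [Ioo_mem_nhdsGT (zero_lt_one' ℝ)] with t ht
  have hc := hf.2 (Set.mem_univ x) (Set.mem_univ y) (sub_nonneg.2 ht.2.le) ht.1.le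
    (sub_add_cancel 1 t)
  have e : (1 - t) • x + t • y = x + t • (y - x) := by module
  rw [e, norm_sub_rev] at hc
  simp only [zero_add, zero_smul, add_zero, smul_eq_mul] at hc ⊢
  rw [inv_mul_le_iff₀ ht.1]
  linarith

lemma _root_.StrongConvexOn.le_inner_sub {f : E → ℝ} {μ : ℝ} (hf : StrongConvexOn Set.univ μ f)
    {g : E → E} (hg : ∀ x, HasGradientAt f (g x) x) (x y : E) :
    μ * ‖y - x‖ ^ 2 ≤ inner ℝ (g y - g x) (y - x) := by
  have h1 := hf.add_inner_le (hg x) y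
  have h2 := hf.add_inner_le (hg y) x
  rw [← neg_sub y x, inner_neg_right, norm_neg] at h2
  rw [inner_sub_left]
  linarith

lemma _root_.StrongConvexOn.le_inner_hessian {f : E → ℝ} {μ : ℝ}
    (hf : StrongConvexOn Set.univ μ f) {g : E → E} (hg : ∀ x, HasGradientAt f (g x) x)
    {x : E} {M : E →L[ℝ] E} (hM : HasFDerivAt g M x) (v : E) :
    μ * ‖v‖ ^ 2 ≤ inner ℝ (M v) v := by
  have hd : HasDerivAt (fun t : ℝ => g (x + t • v)) (M v) 0 := by
    have h1 : HasDerivAt (fun t : ℝ => x + t • v) v 0 := by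
      simpa using ((hasDerivAt_id (0 : ℝ)).smul_const v).const_add x
    have h2 : HasFDerivAt g M (x + (0 : ℝ) • v) := by simpa using hM
    exact h2.comp_hasDerivAt (0 : ℝ) h1
  have ht := hd.tendsto_slope_zero_right.inner (𝕜 := ℝ) (tendsto_const_nhds (x := v))
  refine ge_of_tendsto ht ?_
  filter_upwards [self_mem_nhdsWithin] with t ht
  have ht : 0 < t := ht
  have hm := hf.le_inner_sub hg x (x + t • v)
  rw [add_sub_cancel_left, norm_smul, inner_smul_right, mul_pow, Real.norm_eq_abs, sq_abs] at hm
  simp only [zero_add, zero_smul, add_zero, real_inner_smul_left]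
  rw [← div_eq_inv_mul, le_div_iff₀ ht]
  nlinarith

lemma inner_hessian_comm {f : E → ℝ} {g : E → E} (hg : ∀ x, HasGradientAt f (g x) x)
    {x : E} {M : E →L[ℝ] E} (hM : HasFDerivAt g M x) (v w : E) :
    inner ℝ (M v) w = inner ℝ v (M w) := by
  let J : E →L[ℝ] E →L[ℝ] ℝ :=
    (innerₗ E).mkContinuous₂ 1 fun v w => by simpa using norm_inner_le_norm (𝕜 := ℝ) v w
  have h2 : HasFDerivAt (fun y => InnerProductSpace.toDual ℝ E (g y)) (J ∘L M) x := by
    have h3 : (fun y => InnerProductSpace.toDual ℝ E (g y)) = fun y => J (g y) := by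
      ext y z; simp [J]
    rw [h3]
    exact J.hasFDerivAt.comp x hM
  have := second_derivative_symmetric (f := f) (fun y => (hg y).hasFDerivAt) h2 v w
  rw [← real_inner_comm v (M w)]
  simpa [J] using this

/-- The gradient step `x ↦ x - τ ∇f x` has a derivative of norm at most `1 - τ μ`. Symmetry of the
Hessian matters: for an operator with the same bounds that is not symmetric, step sizes of order
`1 / ℓ` need not contract. The bound is stated for any `q ≥ max (1 - τ μ) 0`, since `1 - τ μ` may be
negative if `E` is trivial. -/
lemma norm_id_sub_smul_hessian_le {f : E → ℝ} {μ ℓ τ q : ℝ}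
    (hf : StrongConvexOn Set.univ μ f) {g : E → E} (hg : ∀ x, HasGradientAt f (g x) x)
    {x : E} {M : E →L[ℝ] E} (hM : HasFDerivAt g M x) (hMℓ : ‖M‖ ≤ ℓ) (hτ : 0 ≤ τ)
    (hτℓ : τ * ℓ ≤ 1) (hq : 0 ≤ q) (hq' : 1 - τ * μ ≤ q) :
    ‖ContinuousLinearMap.id ℝ E - τ • M‖ ≤ q := by
  have he : ∀ v w, inner ℝ ((ContinuousLinearMap.id ℝ E - τ • M) v) w
      = inner ℝ v w - τ * inner ℝ (M v) w := fun v w => by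
    simp [inner_sub_left, real_inner_smul_left]
  refine norm_le_of_symmetric_of_inner_le hq (fun v w => ?_) (fun v => ?_) fun v => ?_
  · rw [real_inner_comm ((ContinuousLinearMap.id ℝ E - τ • M) w), he, he, real_inner_comm w v,
      inner_hessian_comm hg hM w v, real_inner_comm w (M v)]
  · rw [he, real_inner_self_eq_norm_sq]
    have h1 : inner ℝ (M v) v ≤ ℓ * ‖v‖ ^ 2 := by
      have := real_inner_le_norm (M v) v
      have h2 := mul_le_mul_of_nonneg_right (M.le_of_opNorm_le hMℓ v) (norm_nonneg v)
      nlinarith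
    nlinarith [mul_le_mul_of_nonneg_left h1 hτ, mul_le_mul_of_nonneg_right hτℓ (sq_nonneg ‖v‖)]
  · rw [he, real_inner_self_eq_norm_sq]
    nlinarith [mul_le_mul_of_nonneg_left (hf.le_inner_hessian hg hM v) hτ,
      mul_le_mul_of_nonneg_right hq' (sq_nonneg ‖v‖)]

end StrongConvexity

/-! ### Partial gradients -/

section Partial

lemma norm_toLp_sub_toLp_le {E F : Type*} [NormedAddCommGroup E] [NormedAddCommGroup F]
    (x x' : E) (y y' : F) :
    ‖WithLp.toLp 2 (x, y) - WithLp.toLp 2 (x', y')‖ ≤ ‖x - x'‖ + ‖y - y'‖ := by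
  rw [← WithLp.toLp_sub, WithLp.prod_norm_eq_of_L2]
  refine Real.sqrt_le_iff.2 ⟨by positivity, ?_⟩
  simp only [WithLp.toLp_fst, WithLp.toLp_snd, Prod.fst_sub, Prod.snd_sub]
  nlinarith [norm_nonneg (x - x'), norm_nonneg (y - y')]

variable {E F : Type*} [NormedAddCommGroup E] [InnerProductSpace ℝ E] [CompleteSpace E]
  [NormedAddCommGroup F] [InnerProductSpace ℝ F] [CompleteSpace F]

/-- The gradient at `y` of `y' ↦ U (s y') y'` for a map `s` with value `x` and derivative `D`
at `y`. -/
noncomputable def chainGrad (U : E → F → ℝ) (D : F →L[ℝ] E) (x : E) (y : F) : F :=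
  D.adjoint (gradient (joint U) (WithLp.toLp 2 (x, y))).fst
    + (gradient (joint U) (WithLp.toLp 2 (x, y))).snd

lemma hasGradientAt_comp_graph {f : E → F → ℝ} (hf : Differentiable ℝ (joint f)) {s : F → E}
    {D : F →L[ℝ] E} {y : F} (hs : HasFDerivAt s D y) :
    HasGradientAt (fun y => f (s y) y) (chainGrad f D (s y) y) y := by
  have h1 : HasFDerivAt (fun y => WithLp.toLp 2 (s y, y))
      ((WithLp.prodContinuousLinearEquiv 2 ℝ E F).symm.toContinuousLinearMap ∘L
        (D.prod (ContinuousLinearMap.id ℝ F))) y :=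
    HasFDerivAt.comp (f := fun y => (s y, y)) y
      (WithLp.prodContinuousLinearEquiv 2 ℝ E F).symm.hasFDerivAt (hs.prodMk (hasFDerivAt_id y))
  have h2 := HasFDerivAt.comp y (hf (WithLp.toLp 2 (s y, y))).hasGradientAt.hasFDerivAt h1
  refine hasGradientAt_iff_hasFDerivAt.2 (h2.congr_fderiv ?_)
  ext v
  simp only [chainGrad, ContinuousLinearMap.comp_apply, InnerProductSpace.toDual_apply_apply,
    WithLp.prod_inner_apply, inner_add_left, ContinuousLinearMap.adjoint_inner_left]
  rfl

lemma hasGradientAt_fst {f : E → F → ℝ} (hf : Differentiable ℝ (joint f)) (x : E) (y : F) :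
    HasGradientAt (fun x => f x y) (gradient (joint f) (WithLp.toLp 2 (x, y))).fst x := by
  have h1 : HasFDerivAt (fun x => WithLp.toLp 2 (x, y))
      ((WithLp.prodContinuousLinearEquiv 2 ℝ E F).symm.toContinuousLinearMap ∘L
        ((ContinuousLinearMap.id ℝ E).prod 0)) x :=
    HasFDerivAt.comp (f := fun x => (x, y)) x
      (WithLp.prodContinuousLinearEquiv 2 ℝ E F).symm.hasFDerivAt
      ((hasFDerivAt_id x).prodMk (hasFDerivAt_const y x))
  have h2 := HasFDerivAt.comp x (hf (WithLp.toLp 2 (x, y))).hasGradientAt.hasFDerivAt h1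
  refine hasGradientAt_iff_hasFDerivAt.2 (h2.congr_fderiv ?_)
  ext v
  simp only [ContinuousLinearMap.comp_apply, InnerProductSpace.toDual_apply_apply,
    WithLp.prod_inner_apply]
  exact (congrArg _ (inner_zero_right _)).trans (add_zero _)

lemma hasGradientAt_snd {f : E → F → ℝ} (hf : Differentiable ℝ (joint f)) (x : E) (y : F) :
    HasGradientAt (fun y => f x y) (gradient (joint f) (WithLp.toLp 2 (x, y))).snd y := by
  simpa [chainGrad] using hasGradientAt_comp_graph hf (hasFDerivAt_const x y)

lemma norm_gradient_le_of_lipschitz {V : Type*} [NormedAddCommGroup V] [InnerProductSpace ℝ V]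
    [CompleteSpace V] {f : V → ℝ} {ℓ : ℝ≥0} (hf : LipschitzWith ℓ f) (x : V) :
    ‖gradient f x‖ ≤ ℓ := by
  rw [gradient, LinearIsometryEquiv.norm_map]
  exact norm_fderiv_le_of_lipschitz ℝ hf

lemma norm_chainGrad_le {U : E → F → ℝ} {ℓ : ℝ≥0} (hU : LipschitzWith ℓ (joint U))
    {D : F →L[ℝ] E} {d : ℝ} (hD : ‖D‖ ≤ d) (x : E) (y : F) :
    ‖chainGrad U D x y‖ ≤ (d + 1) * ℓ :=
  norm_adjoint_apply_add_le hD
    ((WithLp.norm_fst_le _ _).trans (norm_gradient_le_of_lipschitz hU _))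
    ((WithLp.norm_snd_le _ _).trans (norm_gradient_le_of_lipschitz hU _))

lemma norm_chainGrad_sub_le {U : E → F → ℝ} {ℓ₀ ℓ₁ : ℝ≥0} (hU : LipschitzWith ℓ₀ (joint U))
    (hU' : LipschitzWith ℓ₁ (gradient (joint U))) {D D' : F →L[ℝ] E} {d : ℝ} (hD' : ‖D'‖ ≤ d)
    (x x' : E) (y y' : F) :
    ‖chainGrad U D x y - chainGrad U D' x' y'‖
      ≤ ‖D - D'‖ * ℓ₀ + (d + 1) * (ℓ₁ * (‖x - x'‖ + ‖y - y'‖)) := by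
  have h : ‖gradient (joint U) (WithLp.toLp 2 (x, y)) - gradient (joint U) (WithLp.toLp 2 (x', y'))‖
      ≤ ℓ₁ * (‖x - x'‖ + ‖y - y'‖) :=
    (hU'.norm_sub_le _ _).trans
      (mul_le_mul_of_nonneg_left (norm_toLp_sub_toLp_le x x' y y') ℓ₁.coe_nonneg)
  refine norm_adjoint_apply_add_sub_le hD'
    ((WithLp.norm_fst_le _ _).trans (norm_gradient_le_of_lipschitz hU _)) ?_ ?_
  · rw [← WithLp.sub_fst]; exact (WithLp.norm_fst_le _ _).trans h
  · rw [← WithLp.sub_snd]; exact (WithLp.norm_snd_le _ _).trans h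

end Partial

/-! ### The lower-level problem -/

section LowerLevel

variable {E F : Type*} [NormedAddCommGroup E] [InnerProductSpace ℝ E]
  [NormedAddCommGroup F] [InnerProductSpace ℝ F]

variable (E F) in
/-- The isometric embedding of the first factor in the Euclidean product. -/
noncomputable def inlL : E →L[ℝ] WithLp 2 (E × F) :=
  (WithLp.prodContinuousLinearEquiv 2 ℝ E F).symm.toContinuousLinearMap ∘L
    ContinuousLinearMap.inl ℝ E F

variable (E F) in
/-- The isometric embedding of the second factor in the Euclidean product. -/
noncomputable def inrL : F →L[ℝ] WithLp 2 (E × F) :=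
  (WithLp.prodContinuousLinearEquiv 2 ℝ E F).symm.toContinuousLinearMap ∘L
    ContinuousLinearMap.inr ℝ E F

lemma norm_fstL_comp_comp_le {V : Type*} [NormedAddCommGroup V] [NormedSpace ℝ V]
    (K : WithLp 2 (E × F) →L[ℝ] WithLp 2 (E × F)) (i : V →L[ℝ] WithLp 2 (E × F))
    (hi : ∀ v, ‖i v‖ = ‖v‖) : ‖WithLp.fstL 2 ℝ E F ∘L K ∘L i‖ ≤ ‖K‖ := by
  refine ContinuousLinearMap.opNorm_le_bound _ (norm_nonneg K) fun v => ?_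
  refine (WithLp.norm_fst_le _ (K (i v))).trans ((K.le_opNorm _).trans ?_)
  rw [hi]

lemma norm_inlL (v : E) : ‖inlL E F v‖ = ‖v‖ := WithLp.norm_toLp_fst 2 E F v

lemma norm_inrL (v : F) : ‖inrL E F v‖ = ‖v‖ := WithLp.norm_toLp_snd 2 E F v

lemma norm_starProjection_comp_le {V : Type*} [NormedAddCommGroup V] [NormedSpace ℝ V]
    (K : Submodule ℝ E) [K.HasOrthogonalProjection] (f : V →L[ℝ] E) :
    ‖K.starProjection ∘L f‖ ≤ ‖f‖ :=
  (ContinuousLinearMap.opNorm_comp_le _ _).trans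
    (mul_le_of_le_one_left (norm_nonneg _) K.starProjection_norm_le)

variable [CompleteSpace E] [CompleteSpace F]

/-- One projected gradient step for the lower-level problem at `y`, as a map of the pair. The
partial gradient is written as a component of the gradient of `joint L`. -/
noncomputable def lowerStep (L : E → F → ℝ) (H : AffineSubspace ℝ E) [Nonempty H]
    [H.direction.HasOrthogonalProjection] (τ : ℝ) (x : E) (y : F) : E :=
  proj H (x - τ • (gradient (joint L) (WithLp.toLp 2 (x, y))).fst)

/-- The partial derivative of `lowerStep` in the lower-level variable. -/
noncomputable def lowerStepJacFst (L : E → F → ℝ) (H : AffineSubspace ℝ E)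
    [H.direction.HasOrthogonalProjection] (τ : ℝ) (x : E) (y : F) : E →L[ℝ] E :=
  H.direction.starProjection ∘L (ContinuousLinearMap.id ℝ E - τ •
    (WithLp.fstL 2 ℝ E F ∘L fderiv ℝ (gradient (joint L)) (WithLp.toLp 2 (x, y)) ∘L inlL E F))

/-- The partial derivative of `lowerStep` in the upper-level variable. -/
noncomputable def lowerStepJacSnd (L : E → F → ℝ) (H : AffineSubspace ℝ E)
    [H.direction.HasOrthogonalProjection] (τ : ℝ) (x : E) (y : F) : F →L[ℝ] E :=
  -(H.direction.starProjection ∘L (τ •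
    (WithLp.fstL 2 ℝ E F ∘L fderiv ℝ (gradient (joint L)) (WithLp.toLp 2 (x, y)) ∘L inrL E F)))

variable {U L : E → F → ℝ} {ℓu0 ℓu1 ℓl1 ℓl2 : ℝ≥0} {μ : ℝ}

lemma Regular.isParamContraction (hR : Regular U L ℓu0 ℓu1 ℓl1 ℓl2 μ) (H : AffineSubspace ℝ E)
    [Nonempty H] [H.direction.HasOrthogonalProjection] {τ q : ℝ} (hτ : 0 < τ)
    (hτℓ : τ * ℓl1 ≤ 1) (hq : 0 ≤ q) (hq1 : q < 1) (hqμ : 1 - τ * μ ≤ q) :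
    IsParamContraction (lowerStep L H τ) (lowerStepJacFst L H τ) (lowerStepJacSnd L H τ)
      q (τ * ℓl1) (τ * ℓl2) where
  nonneg_fst := hq
  fst_lt_one := hq1
  nonneg_snd := by positivity
  nonneg_lip := by positivity
  hasFDerivAt x y := by
    have h1 : HasFDerivAt (fun z : E × F => gradient (joint L) (WithLp.toLp 2 (z.1, z.2)))
        (fderiv ℝ (gradient (joint L)) (WithLp.toLp 2 (x, y)) ∘L
          (WithLp.prodContinuousLinearEquiv 2 ℝ E F).symm.toContinuousLinearMap) (x, y) :=
      HasFDerivAt.comp (f := fun z : E × F => WithLp.toLp 2 z) (x, y)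
        (hR.diff_grad_L (WithLp.toLp 2 (x, y))).hasFDerivAt
        (WithLp.prodContinuousLinearEquiv 2 ℝ E F).symm.hasFDerivAt
    have h2 := (WithLp.fstL 2 ℝ E F).hasFDerivAt.comp (x, y) h1
    have h3 := H.direction.starProjection.hasFDerivAt.comp (x, y)
      (hasFDerivAt_fst.sub (h2.const_smul τ))
    have h4 := h3.const_add (proj H 0)
    refine (h4.congr_fderiv ?_).congr_of_eventuallyEq (Filter.Eventually.of_forall fun z => ?_)
    · refine ContinuousLinearMap.ext fun v => ?_
      have e : (WithLp.prodContinuousLinearEquiv 2 ℝ E F).symm v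
          = inlL E F v.1 + inrL E F v.2 := by
        have : v = ContinuousLinearMap.inl ℝ E F v.1 + ContinuousLinearMap.inr ℝ E F v.2 := by
          simp
        conv_lhs => rw [this, map_add]
        rfl
      simp [lowerStepJacFst, lowerStepJacSnd, e]
      abel
    · change proj H _ = proj H 0 + _
      rw [← zero_add (_ - _), proj_add]
      rfl
  norm_fst_le x y := by
    refine (norm_starProjection_comp_le _ _).trans ?_
    have hM : HasFDerivAt (fun x => (gradient (joint L) (WithLp.toLp 2 (x, y))).fst)
        (WithLp.fstL 2 ℝ E F ∘L fderiv ℝ (gradient (joint L)) (WithLp.toLp 2 (x, y)) ∘L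
          inlL E F) x := by
      have h0 : HasFDerivAt (fun x : E => WithLp.toLp 2 (x, y)) (inlL E F) x :=
        (WithLp.prodContinuousLinearEquiv 2 ℝ E F).symm.hasFDerivAt.comp x
          (hasFDerivAt_prodMk_left x y)
      have h1 := HasFDerivAt.comp x (hR.diff_grad_L (WithLp.toLp 2 (x, y))).hasFDerivAt h0
      exact (WithLp.fstL 2 ℝ E F).hasFDerivAt.comp x h1
    exact norm_id_sub_smul_hessian_le (hR.strong y) (fun x => hasGradientAt_fst hR.diff_L x y) hM
      ((norm_fstL_comp_comp_le _ _ norm_inlL).trans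
        (norm_fderiv_le_of_lipschitz ℝ hR.lip_grad_L)) hτ.le hτℓ hq hqμ
  norm_snd_le x y := by
    rw [lowerStepJacSnd, norm_neg]
    refine (norm_starProjection_comp_le _ _).trans ?_
    rw [norm_smul, Real.norm_of_nonneg hτ.le]
    exact mul_le_mul_of_nonneg_left ((norm_fstL_comp_comp_le _ _ norm_inrL).trans
        (norm_fderiv_le_of_lipschitz ℝ hR.lip_grad_L)) hτ.le
  lip_fst x y x' y' := by
    rw [lowerStepJacFst, lowerStepJacFst, ← ContinuousLinearMap.comp_sub, sub_sub_sub_cancel_left,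
      ← smul_sub, ← ContinuousLinearMap.comp_sub, ← ContinuousLinearMap.sub_comp]
    refine (norm_starProjection_comp_le _ _).trans ?_
    rw [norm_smul, Real.norm_of_nonneg hτ.le, mul_assoc]
    refine mul_le_mul_of_nonneg_left ((norm_fstL_comp_comp_le _ _ norm_inlL).trans ?_) hτ.le
    refine (hR.lip_hess_L.norm_sub_le _ _).trans ?_
    rw [add_comm, norm_sub_rev x, norm_sub_rev y, add_comm]
    exact mul_le_mul_of_nonneg_left (norm_toLp_sub_toLp_le _ _ _ _) ℓl2.coe_nonneg
  lip_snd x y x' y' := by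
    rw [lowerStepJacSnd, lowerStepJacSnd, neg_sub_neg, ← ContinuousLinearMap.comp_sub,
      ← smul_sub, ← ContinuousLinearMap.comp_sub, ← ContinuousLinearMap.sub_comp]
    refine (norm_starProjection_comp_le _ _).trans ?_
    rw [norm_smul, Real.norm_of_nonneg hτ.le, mul_assoc]
    refine mul_le_mul_of_nonneg_left ((norm_fstL_comp_comp_le _ _ norm_inrL).trans ?_) hτ.le
    refine (hR.lip_hess_L.norm_sub_le _ _).trans ?_
    rw [norm_sub_rev x, norm_sub_rev y]
    exact mul_le_mul_of_nonneg_left (norm_toLp_sub_toLp_le _ _ _ _) ℓl2.coe_nonneg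

lemma lowerIter_eq_iterate (hL : Differentiable ℝ (joint L)) (H : AffineSubspace ℝ E) [Nonempty H]
    [H.direction.HasOrthogonalProjection] (τ : ℝ) (x : E) (y : F) (K : ℕ) :
    lowerIter L H τ x y K = (fun x' => lowerStep L H τ x' y)^[K] x := by
  induction K with
  | zero => rfl
  | succ K ih =>
    rw [Function.iterate_succ_apply', lowerIter, ih, (hasGradientAt_fst hL _ y).gradient]
    rfl

/-- Fixed points of the projected gradient step satisfy the first-order condition on `H`, and
strong convexity makes the objective grow quadratically around them. -/
lemma quadratic_growth_of_lowerStep_eq (hL : Differentiable ℝ (joint L))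
    (hstrong : ∀ y, StrongConvexOn Set.univ μ fun x => L x y) (H : AffineSubspace ℝ E) [Nonempty H]
    [H.direction.HasOrthogonalProjection] {τ : ℝ} (hτ : τ ≠ 0) {x : E} {y : F}
    (hx : lowerStep L H τ x y = x) : x ∈ H ∧ ∀ x' ∈ H, L x y + μ / 2 * ‖x' - x‖ ^ 2 ≤ L x' y := by
  have hxH : x ∈ H := by rw [← hx]; exact proj_mem H _
  refine ⟨hxH, fun x' hx' => ?_⟩
  set g := (gradient (joint L) (WithLp.toLp 2 (x, y))).fst with hg
  have hPg : H.direction.starProjection g = 0 := by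
    rw [lowerStep, proj_sub, proj_of_mem H hxH, map_smul, sub_eq_self, smul_eq_zero] at hx
    exact hx.resolve_left hτ
  have hinner : inner ℝ g (x' - x) = 0 := by
    have hdir : x' - x ∈ H.direction := AffineSubspace.vsub_mem_direction hx' hxH
    rw [← Submodule.starProjection_eq_self_iff.2 hdir,
      ← Submodule.inner_starProjection_left_eq_right, hPg, inner_zero_left]
  have := (hstrong y).add_inner_le (hasGradientAt_fst hL x y) x'
  rw [hinner] at this
  linarith

lemma isLowerSolution_unique_of_lowerStep_eq (hL : Differentiable ℝ (joint L)) (hμ : 0 < μ)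
    (hstrong : ∀ y, StrongConvexOn Set.univ μ fun x => L x y) (H : AffineSubspace ℝ E) [Nonempty H]
    [H.direction.HasOrthogonalProjection] {τ : ℝ} (hτ : τ ≠ 0) {x : E} {y : F}
    (hx : lowerStep L H τ x y = x) :
    IsLowerSolution L H y x ∧ ∀ x', IsLowerSolution L H y x' → x' = x := by
  obtain ⟨hxH, h⟩ := quadratic_growth_of_lowerStep_eq hL hstrong H hτ hx
  refine ⟨⟨hxH, fun x' hx' => ?_⟩, fun x' hx' => ?_⟩
  · exact (le_add_of_nonneg_right (by positivity)).trans (h x' hx')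
  · have h1 := h x' hx'.1
    have h2 := hx'.2 x hxH
    have h3 : ‖x' - x‖ ^ 2 ≤ 0 := by nlinarith
    exact sub_eq_zero.1 (norm_eq_zero.1 (pow_eq_zero_iff two_ne_zero |>.1
      (le_antisymm h3 (sq_nonneg _))))

end LowerLevel

/-! ### The alternating gradient method -/

section Rate

variable {E F : Type*} [NormedAddCommGroup E] [InnerProductSpace ℝ E] [CompleteSpace E]
  [NormedAddCommGroup F] [InnerProductSpace ℝ F] [CompleteSpace F]
  {U L : E → F → ℝ} {ℓu0 ℓu1 ℓl1 ℓl2 : ℝ≥0} {μ : ℝ}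

/-- The factor by which one lower-level step contracts. It is truncated at `0` because `1 - τ μ` can
be negative when the lower-level space is trivial. -/
def contractionFactor (τ μ : ℝ) : ℝ := max (1 - τ * μ) 0

lemma contractionFactor_lt_one {τ μ : ℝ} (hτ : 0 < τ) (hμ : 0 < μ) : contractionFactor τ μ < 1 :=
  max_lt (by linarith [mul_pos hτ hμ]) one_pos

lemma Regular.isParamContraction_contractionFactor (hR : Regular U L ℓu0 ℓu1 ℓl1 ℓl2 μ)
    (hμ : 0 < μ) (H : AffineSubspace ℝ E) [Nonempty H] [H.direction.HasOrthogonalProjection]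
    {τ : ℝ} (hτ : 0 < τ) (hτℓ : τ * ℓl1 ≤ 1) :
    IsParamContraction (lowerStep L H τ) (lowerStepJacFst L H τ) (lowerStepJacSnd L H τ)
      (contractionFactor τ μ) (τ * ℓl1) (τ * ℓl2) :=
  hR.isParamContraction H hτ hτℓ (le_max_right _ _) (contractionFactor_lt_one hτ hμ)
    (le_max_left _ _)

lemma Regular.existsUnique_isLowerSolution (hR : Regular U L ℓu0 ℓu1 ℓl1 ℓl2 μ)
    (hμ : 0 < μ) (H : AffineSubspace ℝ E) [Nonempty H] [H.direction.HasOrthogonalProjection]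
    {τ : ℝ} (hτ : 0 < τ) (hτℓ : τ * ℓl1 ≤ 1) (y : F) : ∃! x, IsLowerSolution L H y x := by
  obtain ⟨x, hx⟩ := (hR.isParamContraction_contractionFactor hμ H hτ hτℓ).exists_fixedPoint y
  exact ⟨x, isLowerSolution_unique_of_lowerStep_eq hR.diff_L hμ hR.strong H hτ.ne' hx⟩

lemma Regular.lowerStep_etaStar (hR : Regular U L ℓu0 ℓu1 ℓl1 ℓl2 μ)
    (hμ : 0 < μ) (H : AffineSubspace ℝ E) [Nonempty H] [H.direction.HasOrthogonalProjection]
    {τ : ℝ} (hτ : 0 < τ) (hτℓ : τ * ℓl1 ≤ 1) (y : F) :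
    lowerStep L H τ (etaStar L H y) y = etaStar L H y := by
  obtain ⟨x, hx⟩ := (hR.isParamContraction_contractionFactor hμ H hτ hτℓ).exists_fixedPoint y
  obtain ⟨h1, h2⟩ := isLowerSolution_unique_of_lowerStep_eq hR.diff_L hμ hR.strong H hτ.ne' hx
  have h3 : etaStar L H y = x := h2 _ (Classical.epsilon_spec ⟨x, h1⟩)
  rw [h3, hx]

lemma hyperGrad_eq_chainGrad (hU : Differentiable ℝ (joint U)) (H : AffineSubspace ℝ E)
    [Nonempty H] [H.direction.HasOrthogonalProjection] {τ : ℝ} {K : ℕ} {x : E} {y : F}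
    {D : F →L[ℝ] E} (hD : HasFDerivAt (fun y' => lowerIter L H τ x y' K) D y) :
    hyperGrad U L H τ K x y = chainGrad U D (lowerIter L H τ x y K) y := by
  rw [hyperGrad, hD.fderiv, (hasGradientAt_fst hU _ y).gradient,
    (hasGradientAt_snd hU (lowerIter L H τ x y K) y).gradient]
  rfl

lemma pow_le_one_div_of_log_le {r : ℝ} (hr : 0 < r) (hr1 : r < 1) {N K : ℕ} (hN : 1 ≤ N)
    (hK : 1 / -Real.log r * Real.log N ≤ K) : r ^ K ≤ 1 / N := by
  have hlog : 0 < -Real.log r := neg_pos.2 (Real.log_neg hr hr1)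
  have hN0 : (0 : ℝ) < N := by exact_mod_cast hN
  rw [one_div_mul_eq_div, div_le_iff₀ hlog] at hK
  rw [← Real.log_le_log_iff (pow_pos hr K) (by positivity), Real.log_pow, one_div, Real.log_inv]
  linarith

/-- A Lipschitz constant of the gradient of `upperObj`, where `d` bounds the derivative of the
lower-level solution map and `q`, `a` are the constants of `IsParamContraction`. -/
noncomputable def upperObjLip (ℓu0 ℓu1 q d a : ℝ) : ℝ :=
  a * (1 + d) ^ 2 / (1 - q) * ℓu0 + (d + 1) * (ℓu1 * (d + 1))

/-- The bound of `sum_stationarity_le`. -/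
noncomputable def rateConst (τ G M c₁ c₂ d : ℝ) : ℝ :=
  (M + G) ^ 2 + (2 / τ * (M + G * (M + τ * G)) + (c₁ + c₂ * (M + 2 * (d * (M + τ * G)))) ^ 2)

lemma IsParamContraction.hasFDerivAt_lowerIter (hL : Differentiable ℝ (joint L))
    {H : AffineSubspace ℝ E} [Nonempty H] [H.direction.HasOrthogonalProjection] {τ q b a : ℝ}
    (hT : IsParamContraction (lowerStep L H τ) (lowerStepJacFst L H τ) (lowerStepJacSnd L H τ)
      q b a) (x : E) (y : F) (K : ℕ) :
    HasFDerivAt (fun y => lowerIter L H τ x y K)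
      (iterJac (lowerStep L H τ) (lowerStepJacFst L H τ) (lowerStepJacSnd L H τ) x y K) y := by
  simp only [lowerIter_eq_iterate hL]
  exact hT.hasFDerivAt_iterate x y K

lemma IsParamContraction.differentiable_upperObj (hU : Differentiable ℝ (joint U))
    {H : AffineSubspace ℝ E} [Nonempty H] [H.direction.HasOrthogonalProjection] {τ q b a : ℝ}
    (hT : IsParamContraction (lowerStep L H τ) (lowerStepJacFst L H τ) (lowerStepJacSnd L H τ)
      q b a) (hs : ∀ y, lowerStep L H τ (etaStar L H y) y = etaStar L H y) :
    Differentiable ℝ (upperObj U L H) := by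
  choose D hD using fun y => hT.exists_linearized_fixedPoint (etaStar L H y) y
  exact fun y => (hasGradientAt_comp_graph hU
    (hT.hasFDerivAt_fixedPoint hs hD y)).differentiableAt

/-- The rate of the alternating gradient method. Differentiating the lower-level loop gives the
hypergradient up to an error `r ^ K * (c₁ + c₂ * ‖η - η*(ξ)‖)`, and one loop shrinks
`‖η - η*(ξ)‖` by the factor `r ^ K` before `ξ` moves; the rest is `sum_stationarity_le`. -/
theorem Regular.sum_stationarity_agm_le (hR : Regular U L ℓu0 ℓu1 ℓl1 ℓl2 μ)
    {H : AffineSubspace ℝ E} [Nonempty H] [H.direction.HasOrthogonalProjection] {τl q b a : ℝ}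
    (hT : IsParamContraction (lowerStep L H τl) (lowerStepJacFst L H τl) (lowerStepJacSnd L H τl)
      q b a) (hs : ∀ y, lowerStep L H τl (etaStar L H y) y = etaStar L H y)
    (S : AffineSubspace ℝ F) [Nonempty S] [S.direction.HasOrthogonalProjection]
    {τu : ℝ} (hτu : 0 < τu) (hτuL : 2 * upperObjLip ℓu0 ℓu1 q (b / (1 - q)) a * τu ≤ 1)
    {r : ℝ} (hqr : q < r) {N K : ℕ} (hN : 1 ≤ N) (hrN : r ^ K ≤ 1 / N) {M : ℝ} {x : E} {y : F}
    (hMu : ∀ y' ∈ S, upperObj U L H y - upperObj U L H y' ≤ M)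
    (hMe : ‖x - etaStar L H y‖ ≤ M) (hMξ : ‖y - proj S y‖ ≤ M) :
    ∑ k ∈ Finset.range N, stationarity U L H S (agm U L H S τl τu K x y k).2
      ≤ rateConst τu ((b / (1 - q) + 1) * ℓu0) M (b / (1 - q) * ℓu0)
        (a * (1 + b / (1 - q)) / (r - q) * ℓu0 + (b / (1 - q) + 1) * ℓu1) (b / (1 - q)) := by
  choose D hD using fun y => hT.exists_linearized_fixedPoint (etaStar L H y) y
  have h1 := hT.one_sub_pos
  have hd : 0 ≤ b / (1 - q) := div_nonneg hT.nonneg_snd h1.le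
  have hit := hT.hasFDerivAt_lowerIter hR.diff_L
  have hu : ∀ y, HasGradientAt (upperObj U L H) (chainGrad U (D y) (etaStar L H y) y) y := fun y =>
    hasGradientAt_comp_graph hR.diff_U (hT.hasFDerivAt_fixedPoint hs hD y)
  have hcontr : ∀ η ξ, ‖lowerIter L H τl η ξ K - etaStar L H ξ‖
      ≤ r ^ K * ‖η - etaStar L H ξ‖ := fun η ξ => by
    rw [lowerIter_eq_iterate hR.diff_L]
    exact (hT.norm_iterate_sub_le hs η ξ K).trans (mul_le_mul_of_nonneg_right
      (pow_le_pow_left₀ hT.nonneg_fst hqr.le K) (norm_nonneg _))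
  have hgrad : gradient (upperObj U L H) = fun y => chainGrad U (D y) (etaStar L H y) y :=
    gradient_eq hu
  have hr0 : 0 ≤ r := hT.nonneg_fst.trans hqr.le
  have ha : 0 ≤ a * (1 + b / (1 - q)) := mul_nonneg hT.nonneg_lip (by linarith)
  simp only [stationarity, hgrad]
  refine sum_stationarity_le S hu (fun y => norm_chainGrad_le hR.lip_U
    (hT.norm_deriv_fixedPoint_le hD y) _ _)
    (ℓ := upperObjLip ℓu0 ℓu1 q (b / (1 - q)) a) ?_ ?_ hτu hτuL
    (ξ := fun k => (agm U L H S τl τu K x y k).2)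
    (v := fun k => hyperGrad U L H τl K (agm U L H S τl τu K x y k).1
      (agm U L H S τl τu K x y k).2)
    (e := fun k => ‖(agm U L H S τl τu K x y k).1 - etaStar L H (agm U L H S τl τu K x y k).2‖)
    (fun k => norm_nonneg _) (fun k => rfl) ?_ hN (pow_nonneg hr0 K) hrN ?_ hd ?_ ?_ hMu hMe hMξ
  · intro y y'
    refine (norm_chainGrad_sub_le hR.lip_U hR.lip_grad_U (hT.norm_deriv_fixedPoint_le hD y')
      _ _ _ _).trans ?_
    have h2 := mul_le_mul_of_nonneg_right (hT.norm_deriv_fixedPoint_sub_le hs hD y y')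
      ℓu0.coe_nonneg
    have h3 : ‖etaStar L H y - etaStar L H y'‖ + ‖y - y'‖ ≤ (b / (1 - q) + 1) * ‖y - y'‖ := by
      linarith [hT.norm_fixedPoint_sub_le hs y y']
    have h4 := mul_le_mul_of_nonneg_left (mul_le_mul_of_nonneg_left h3 ℓu1.coe_nonneg)
      (by linarith : 0 ≤ b / (1 - q) + 1)
    rw [upperObjLip]
    linarith
  · have := hT.nonneg_lip
    rw [upperObjLip]
    positivity
  · intro k
    simp only [hyperGrad_eq_chainGrad hR.diff_U H (hit _ _ _)]
    exact norm_chainGrad_le hR.lip_U (hT.norm_iterJac_le _ _ _) _ _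
  · have : 0 < r - q := sub_pos.2 hqr
    positivity
  · intro k
    simp only [hyperGrad_eq_chainGrad hR.diff_U H (hit _ _ _)]
    set η := (agm U L H S τl τu K x y k).1
    set ξ := (agm U L H S τl τu K x y k).2
    refine (norm_chainGrad_sub_le hR.lip_U hR.lip_grad_U (hT.norm_deriv_fixedPoint_le hD ξ)
      _ _ _ _).trans ?_
    have h2 := mul_le_mul_of_nonneg_right (hT.norm_iterJac_sub_le hs hD hqr η ξ K)
      ℓu0.coe_nonneg
    have h4 := mul_le_mul_of_nonneg_left (mul_le_mul_of_nonneg_left (hcontr η ξ) ℓu1.coe_nonneg)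
      (by linarith : 0 ≤ b / (1 - q) + 1)
    rw [sub_self, norm_zero, add_zero]
    linarith
  · intro k
    set η := (agm U L H S τl τu K x y k).1
    set ξ := (agm U L H S τl τu K x y k).2
    refine (norm_sub_le_norm_sub_add_norm_sub _ (etaStar L H ξ) _).trans ?_
    exact add_le_add (hcontr η ξ) (hT.norm_fixedPoint_sub_le hs _ _)

end Rate

end Bilevel

theorem theorem3 (ℓu0 ℓu1 ℓl1 ℓl2 : ℝ≥0) (μ τl : ℝ) (hμ : 0 < μ) (hτl : 0 < τl)
    (hτl' : τl ≤ 1 / (2 * (ℓl1 : ℝ))) :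
    -- the largest upper-level step size and the factor in the number of lower-level steps
    -- depend only on the constants above
    ∃ τmax > (0 : ℝ), ∃ κ > (0 : ℝ), ∀ τu : ℝ, 0 < τu → τu ≤ τmax → ∀ M : ℝ,
    -- the constant of the rate depends only on these, on the step size and on `M`
    ∃ C : ℝ, ∀ (dη dξ dA dB : ℕ)
      (A : Matrix (Fin dA) (Fin dη) ℝ) (c : Fin dA → ℝ) (_ : Nonempty (linearSystem A c))
      (B : Matrix (Fin dB) (Fin dξ) ℝ) (e : Fin dB → ℝ) (_ : Nonempty (linearSystem B e))
      (U L : EuclideanSpace ℝ (Fin dη) → EuclideanSpace ℝ (Fin dξ) → ℝ),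
      Bilevel.Regular U L ℓu0 ℓu1 ℓl1 ℓl2 μ →
      -- well-posedness: the lower-level solution is unique, `u` is differentiable, and so are the
      -- lower-level iterates as functions of the upper-level variable
      (∀ ξ, ∃! η, Bilevel.IsLowerSolution L (linearSystem A c) ξ η) ∧
      Differentiable ℝ (Bilevel.upperObj U L (linearSystem A c)) ∧
      (∀ η K, Differentiable ℝ fun ξ => Bilevel.lowerIter L (linearSystem A c) τl η ξ K) ∧
      -- rate of convergence
      ∀ (η₁ : EuclideanSpace ℝ (Fin dη)) (ξ₁ : EuclideanSpace ℝ (Fin dξ)),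
        (∀ ξ ∈ linearSystem B e, Bilevel.upperObj U L (linearSystem A c) ξ₁
            - Bilevel.upperObj U L (linearSystem A c) ξ ≤ M) →
        ‖η₁ - Bilevel.etaStar L (linearSystem A c) ξ₁‖ ≤ M →
        ‖ξ₁ - Bilevel.proj (linearSystem B e) ξ₁‖ ≤ M →
        ∀ Ku Kl : ℕ, 1 ≤ Ku → κ * Real.log Ku ≤ Kl →
          1 / (Ku : ℝ) * ∑ k ∈ Finset.range Ku,
            Bilevel.stationarity U L (linearSystem A c) (linearSystem B e)
              (Bilevel.agm U L (linearSystem A c) (linearSystem B e) τl τu Kl η₁ ξ₁ k).2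
          ≤ C / Ku := by
  -- For `ℓl1 = 0` the bound on `τl` reads `τl ≤ 1 / 0 = 0`.
  have hℓ : 0 < (ℓl1 : ℝ) := by
    by_contra h
    rw [le_antisymm (not_lt.1 h) ℓl1.coe_nonneg] at hτl'
    norm_num at hτl'
    linarith
  have hτℓ : τl * ℓl1 ≤ 1 := by
    rw [le_div_iff₀ (by positivity)] at hτl'
    linarith
  set q := Bilevel.contractionFactor τl μ
  have hq0 : 0 ≤ q := le_max_right _ _
  have hq1 : q < 1 := Bilevel.contractionFactor_lt_one hτl hμ
  set d := τl * ℓl1 / (1 - q)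
  have hd : 0 ≤ d := div_nonneg (by positivity) (by linarith)
  set ℓ := Bilevel.upperObjLip ℓu0 ℓu1 q d (τl * ℓl2) with hℓu
  have hℓu0 : 0 ≤ ℓ := by
    have : 0 < 1 - q := by linarith
    rw [hℓu, Bilevel.upperObjLip]
    positivity
  -- The rate `r` is the midpoint of `q` and `1`, which is positive even for `q = 0`.
  have hr0 : 0 < (1 + q) / 2 := by linarith
  have hr1 : (1 + q) / 2 < 1 := by linarith
  -- The descent inequality needs `2 ℓ τu ≤ 1`; the summand `1` covers the case `ℓ = 0`.
  refine ⟨1 / (2 * ℓ + 1), by positivity, 1 / -Real.log ((1 + q) / 2),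
    one_div_pos.2 (neg_pos.2 (Real.log_neg hr0 hr1)), fun τu hτu hτu' M => ?_⟩
  have hτuℓ : 2 * ℓ * τu ≤ 1 := by
    rw [le_div_iff₀ (by positivity)] at hτu'
    linarith
  refine ⟨Bilevel.rateConst τu ((d + 1) * ℓu0) M (d * ℓu0)
    (τl * ℓl2 * (1 + d) / ((1 + q) / 2 - q) * ℓu0 + (d + 1) * ℓu1) d,
    fun dη dξ dA dB A c _ B e _ U L hR => ?_⟩
  have hT := hR.isParamContraction_contractionFactor hμ (linearSystem A c) hτl hτℓ
  have hs := hR.lowerStep_etaStar hμ (linearSystem A c) hτl hτℓ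
  refine ⟨hR.existsUnique_isLowerSolution hμ (linearSystem A c) hτl hτℓ,
    hT.differentiable_upperObj hR.diff_U hs,
    fun η K ξ => (hT.hasFDerivAt_lowerIter hR.diff_L η ξ K).differentiableAt, ?_⟩
  intro η₁ ξ₁ hMu hMe hMξ Ku Kl hKu hKl
  have h := hR.sum_stationarity_agm_le hT hs (linearSystem B e) hτu hτuℓ
    (by linarith : q < (1 + q) / 2) hKu
    (Bilevel.pow_le_one_div_of_log_le hr0 hr1 hKu hKl) hMu hMe hMξ
  rw [one_div_mul_eq_div]
  exact div_le_div_of_nonneg_right h (Nat.cast_nonneg _)
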